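/- **3-butterflies.** A 3-butterfly is a 6-tuple of integers $(p,n,q,m,s,l)$ with $p\ge q\ge s\ge 2$, $p+1\le s+q$, $1\le n\le p$, $1\le m\le q$, $1\le l\le s$, $n+m\ne q+1$, $n+l\ne p+1$, and such that - if $m>q+s-p$, then $n+m\ne 2q+1$ and $n+m\neq 2q-p+1$; - if $l\le p-q$, then $n+l\ne p-s+1$; - if $m\le q+s-p$, then $m+l\ne s+1$. Put $t=p+q-s$, $v=q+s-p$, $w=p+s-q$, and let $A=\{a_i: i\in\mathbb Z/2p\}$, $B=\{b_j: j\in\mathbb Z/2q\}$, $C=\{c_k: k\in\mathbb Z/2s\}$ be disjoint sets of labels. Let $\gamma$ and $\phi$ be the involutions of $A\cup B\cup C$ given by $\gamma(a_i)=a_{-i}$, $\gamma(b_j)=b_{-j}$, $\gamma(c_k)=c_{-k}$ and $$a_{n-i}\leftrightarrow b_{m+i-1}\ (1\le i\le t),\qquad a_{n+j}\leftrightarrow c_{l-j-1}\ (0\le j\le w-1),\qquad b_{m-h}\leftrightarrow c_{l+h-1}\ (1\le h\le v).$$ Let $\mu=\phi\gamma$ (first $\gamma$, then $\phi$) and $E=\{a_0,a_p,b_0,b_q,c_0,c_s\}$.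 **The diagram.** The link diagram of the 3-butterfly is the following. Draw three segments $a,b,c$, divided in $p,q,s$ equal parts, respectively, and label the boundary of a thin neighbourhood of $a$ counterclockwise by $a_0,\dots,a_{2p-1}$, where $a_0,a_p$ are the endpoints of the segment $a$ and, for $0<i<p$, the labels $a_i$ and $a_{2p-i}$ lie on the two sides of the $i$-th division point; do the same for $b$ and $c$. At the $i$-th division point, an arc from $a_i$ to $a_{2p-i}$ crosses under the segment $a$, and likewise for $b$ and $c$. Outside these neighbourhoods, each label $x$ is joined to $\phi(x)$ by an arc, these arcs being pairwise disjoint. A *bridge* of a link diagram is a maximal overpass containing at least one overcrossing. A component of a diagram is *trivial* if it passes under at all of its crossings, or over at all of its crossings (so it is a simple closed curve lying entirely below, or entirely above, the rest of the diagram). The 3-butterfly is *reduced*, and $(p/n,q/m,s/l)$ is called a *Schubert form* of a 3-bridge link, if its diagram has exactly three bridges and no trivial component. **Theorem.** Let $(p,n,q,m,s,l)$ be a 3-butterfly. Then $(p/n,q/m,s/l)$ is a Schubert form of a 3-bridge link if and only if $\mu=\tau_1\tau_2\tau_3$ for three pairwise disjoint cycles $\tau_1,\tau_2,\tau_3$,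 each of which contains exactly two elements of $E$. -/

import Mathlib

/-! ## Link diagrams -/

/-- A link diagram, recorded up to isotopy by its crossings and the way they are connected.
At every crossing `x` four ends of strands meet, `(x, 0), (x, 1), (x, 2), (x, 3)` in
counterclockwise order; `(x, 0)` and `(x, 2)` are the two ends of the strand that passes under,
`(x, 1)` and `(x, 3)` are the two ends of the strand that passes over. The edges of the diagram
join these ends in pairs: `join` exchanges the two ends of each edge.
Circles without crossings are not recorded, and planarity is not part of the data: the diagrams
considered below are drawn in the plane and each of their components has a crossing. -/
structure LinkDiagram where
  /-- the crossings -/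
  Crossing : Type
  finite_crossing : Finite Crossing
  /-- the other end of the same edge -/
  join : Crossing × Fin 4 → Crossing × Fin 4
  join_join : ∀ d, join (join d) = d
  join_ne : ∀ d, join d ≠ d

namespace LinkDiagram

variable (D : LinkDiagram)

/-- The strand end `d` belongs to the overpassing strand of its crossing. -/
def IsOver (d : D.Crossing × Fin 4) : Prop := d.2 = 1 ∨ d.2 = 3

/-- The strand end `d` belongs to the underpassing strand of its crossing. -/
def IsUnder (d : D.Crossing × Fin 4) : Prop := d.2 = 0 ∨ d.2 = 2

/-- Two strand ends lie on the same component of the link if one gets from one to the other by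
running along edges and going straight through crossings. -/
def SameComponent : D.Crossing × Fin 4 → D.Crossing × Fin 4 → Prop :=
  Relation.EqvGen fun d d' => d' = D.join d ∨ d' = (d.1, d.2 + 2)

/-- A component is trivial if it passes under at all of its crossings, or passes over at all of
its crossings. (It then has no crossing with itself, so it is a simple closed curve lying entirely
below, or entirely above, the rest of the diagram.) -/
def HasTrivialComponent : Prop :=
  ∃ d, (∀ d', D.SameComponent d d' → D.IsUnder d') ∨ (∀ d', D.SameComponent d d' → D.IsOver d')

/-- Each crossing has exactly one overpassing strand. The overpassing strands at `x` and at `y` are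
on the same bridge if they are linked by a chain of edges joining overpasses to overpasses. -/
def bridgeSetoid : Setoid D.Crossing :=
  Relation.EqvGen.setoid fun x y => ∃ i j : Fin 4,
    D.IsOver (x, i) ∧ D.IsOver (y, j) ∧ D.join (x, i) = (y, j)

/-- The number of bridges, i.e. of maximal overpasses (with at least one overcrossing). -/
noncomputable def numBridges : ℕ := Nat.card (Quotient D.bridgeSetoid)

end LinkDiagram

/-! ## 3-butterflies -/

/-- A 3-butterfly `(p, n, q, m, s, l)`. -/
structure ThreeButterfly where
  (p n q m s l : ℕ)
  hpq : q ≤ p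
  hqs : s ≤ q
  hs : 2 ≤ s
  hn : 1 ≤ n ∧ n ≤ p
  hm : 1 ≤ m ∧ m ≤ q
  hl : 1 ≤ l ∧ l ≤ s
  hpsq : p + 1 ≤ s + q
  hnm : n + m ≠ q + 1
  hnl : n + l ≠ p + 1
  hnm' : (m : ℤ) > q + s - p →
    (n + m : ℤ) ≠ 2 * q + 1 ∧ (n + m : ℤ) ≠ 2 * q - p + 1
  hnl' : (l : ℤ) ≤ p - q → (n + l : ℤ) ≠ p - s + 1
  hml : (m : ℤ) ≤ q + s - p → m + l ≠ s + 1

/-- The names of the three bridges. -/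
inductive BridgeName
  | a | b | c

instance : Finite BridgeName :=
  Finite.of_injective (fun | .a => (0 : Fin 3) | .b => 1 | .c => 2) (by
    rintro (_ | _ | _) (_ | _ | _) h <;> simp_all)

namespace ThreeButterfly

variable (B : ThreeButterfly)

/-- Bridges `a`, `b`, `c` are divided in `p`, `q`, `s` segments. -/
def len : BridgeName → ℕ
  | .a => B.p
  | .b => B.q
  | .c => B.s

/-- The set `A ∪ B ∪ C` of the labels `a_i`, `i ∈ ℤ/2p`, `b_j`, `j ∈ ℤ/2q`, `c_k`, `k ∈ ℤ/2s`. -/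
abbrev Label : Type := (β : BridgeName) × ZMod (2 * B.len β)

/-- The label `a_i`. -/
abbrev la (i : ZMod (2 * B.p)) : B.Label := ⟨.a, i⟩
/-- The label `b_j`. -/
abbrev lb (j : ZMod (2 * B.q)) : B.Label := ⟨.b, j⟩
/-- The label `c_k`. -/
abbrev lc (k : ZMod (2 * B.s)) : B.Label := ⟨.c, k⟩

/-- The number of arcs between bridges `a` and `b`. -/
def t : ℕ := B.p + B.q - B.s
/-- The number of arcs between bridges `b` and `c`. -/
def v : ℕ := B.q + B.s - B.p
/-- The number of arcs between bridges `c` and `a`. -/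
def w : ℕ := B.p + B.s - B.q

theorem two_le_len (β : BridgeName) : 2 ≤ B.len β := by
  have := B.hpq; have := B.hqs; have := B.hs
  cases β <;> simp only [len] <;> omega

instance (β : BridgeName) : NeZero (2 * B.len β) :=
  ⟨by have := B.two_le_len β; omega⟩
instance : NeZero (2 * B.p) := inferInstanceAs (NeZero (2 * B.len .a))
instance : NeZero (2 * B.q) := inferInstanceAs (NeZero (2 * B.len .b))
instance : NeZero (2 * B.s) := inferInstanceAs (NeZero (2 * B.len .c))

/-- The reflection along the bridges, `a_i ↦ a_{2p-i}`, `b_j ↦ b_{2q-j}`, `c_k ↦ c_{2s-k}`. -/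
def gamma : Equiv.Perm B.Label :=
  Function.Involutive.toPerm (fun x => ⟨x.1, -x.2⟩) (fun x => by simp)

/-- `φ` on the labels `a_x`. -/
def phiA (x : ZMod (2 * B.p)) : B.Label :=
  let k := (B.n - 1 - x : ZMod (2 * B.p)).val
  if k < B.t then B.lb (B.m + k) else B.lc (B.l - (2 * B.p - 1 - k : ℕ) - 1)

/-- `φ` on the labels `b_y`. -/
def phiB (y : ZMod (2 * B.q)) : B.Label :=
  let k := (y - B.m : ZMod (2 * B.q)).val
  if k < B.t then B.la (B.n - 1 - k) else B.lc (B.l + (2 * B.q - k : ℕ) - 1)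

/-- `φ` on the labels `c_z`. -/
def phiC (z : ZMod (2 * B.s)) : B.Label :=
  let k := (z - B.l : ZMod (2 * B.s)).val
  if k < B.v then B.lb (B.m - 1 - k) else B.la (B.n + (2 * B.s - 1 - k : ℕ))

/-- The map exchanging `a_{n-i}` with `b_{m+i-1}` for `1 ≤ i ≤ t`, `a_{n+j}` with `c_{l-j-1}` for
`0 ≤ j ≤ w-1`, and `b_{m-h}` with `c_{l+h-1}` for `1 ≤ h ≤ v`. It is characterized by the theorems
`phiFun_ab`, `phiFun_ac`, `phiFun_bc` below. -/
def phiFun : B.Label → B.Label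
  | ⟨.a, x⟩ => B.phiA x
  | ⟨.b, y⟩ => B.phiB y
  | ⟨.c, z⟩ => B.phiC z

theorem tvw : B.t + B.w = 2 * B.p ∧ B.t + B.v = 2 * B.q ∧ B.v + B.w = 2 * B.s := by
  have := B.hpq; have := B.hqs; have := B.hs; have := B.hpsq
  simp only [t, v, w]; omega

theorem val_neg_natCast {N k : ℕ} [NeZero N] (h1 : 1 ≤ k) (h2 : k ≤ N) :
    (-(k : ZMod N)).val = N - k := by
  have h : (-(k : ZMod N)) = ((N - k : ℕ) : ZMod N) := by
    rw [Nat.cast_sub h2]; simp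
  rw [h, ZMod.val_natCast_of_lt (by omega)]

theorem phiFun_ab (i : ℕ) (h1 : 1 ≤ i) (h2 : i ≤ B.t) :
    B.phiFun (B.la (B.n - i)) = B.lb (B.m + i - 1) ∧
    B.phiFun (B.lb (B.m + i - 1)) = B.la (B.n - i) := by
  obtain ⟨k, rfl⟩ : ∃ k, i = k + 1 := ⟨i - 1, by omega⟩
  have := B.tvw
  have hv := B.hpsq
  have e1 : ZMod.val (n := 2 * B.p) (B.n - 1 - (B.n - (k + 1 : ℕ))) = k := by
    rw [show ((B.n : ZMod (2 * B.p)) - 1 - (B.n - (k + 1 : ℕ))) = (k : ℕ) by push_cast; ring]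
    exact ZMod.val_natCast_of_lt (by omega)
  have e2 : ZMod.val (n := 2 * B.q) (B.m + (k + 1 : ℕ) - 1 - B.m) = k := by
    rw [show ((B.m : ZMod (2 * B.q)) + (k + 1 : ℕ) - 1 - B.m) = (k : ℕ) by push_cast; ring]
    exact ZMod.val_natCast_of_lt (by omega)
  constructor
  · simp only [phiFun, phiA, e1, if_pos (show k < B.t by omega)]
    congr 1; push_cast; ring
  · simp only [phiFun, phiB, e2, if_pos (show k < B.t by omega)]
    congr 1; push_cast; ring

theorem phiFun_ac (j : ℕ) (hj : j < B.w) :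
    B.phiFun (B.la (B.n + j)) = B.lc (B.l - j - 1) ∧
    B.phiFun (B.lc (B.l - j - 1)) = B.la (B.n + j) := by
  have := B.tvw
  have e1 : ZMod.val (n := 2 * B.p) (B.n - 1 - (B.n + j)) = 2 * B.p - (j + 1) := by
    rw [show ((B.n : ZMod (2 * B.p)) - 1 - (B.n + j)) = -((j + 1 : ℕ)) by push_cast; ring]
    exact val_neg_natCast (by omega) (by omega)
  have e2 : ZMod.val (n := 2 * B.s) (B.l - j - 1 - B.l) = 2 * B.s - (j + 1) := by
    rw [show ((B.l : ZMod (2 * B.s)) - j - 1 - B.l) = -((j + 1 : ℕ)) by push_cast; ring]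
    exact val_neg_natCast (by omega) (by omega)
  constructor
  · simp only [phiFun, phiA, e1, if_neg (show ¬ (2 * B.p - (j + 1) < B.t) by omega)]
    rw [show 2 * B.p - 1 - (2 * B.p - (j + 1)) = j by omega]
  · simp only [phiFun, phiC, e2, if_neg (show ¬ (2 * B.s - (j + 1) < B.v) by omega)]
    rw [show 2 * B.s - 1 - (2 * B.s - (j + 1)) = j by omega]

theorem phiFun_bc (h : ℕ) (h1 : 1 ≤ h) (h2 : h ≤ B.v) :
    B.phiFun (B.lb (B.m - h)) = B.lc (B.l + h - 1) ∧
    B.phiFun (B.lc (B.l + h - 1)) = B.lb (B.m - h) := by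
  obtain ⟨k, rfl⟩ : ∃ k, h = k + 1 := ⟨h - 1, by omega⟩
  have := B.tvw
  have e1 : ZMod.val (n := 2 * B.q) (B.m - (k + 1 : ℕ) - B.m) = 2 * B.q - (k + 1) := by
    rw [show ((B.m : ZMod (2 * B.q)) - (k + 1 : ℕ) - B.m) = -((k + 1 : ℕ)) by push_cast; ring]
    exact val_neg_natCast (by omega) (by omega)
  have e2 : ZMod.val (n := 2 * B.s) (B.l + (k + 1 : ℕ) - 1 - B.l) = k := by
    rw [show ((B.l : ZMod (2 * B.s)) + (k + 1 : ℕ) - 1 - B.l) = (k : ℕ) by push_cast; ring]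
    exact ZMod.val_natCast_of_lt (by have := B.hs; have := B.hqs; have := B.hpq; omega)
  constructor
  · simp only [phiFun, phiB, e1, if_neg (show ¬ (2 * B.q - (k + 1) < B.t) by omega)]
    rw [show 2 * B.q - (2 * B.q - (k + 1)) = k + 1 by omega]
  · simp only [phiFun, phiC, e2, if_pos (show k < B.v by omega)]
    congr 1; push_cast; ring

/-- Every label occurs in exactly one of the three families. -/
theorem label_cases (x : B.Label) :
    (∃ i : ℕ, 1 ≤ i ∧ i ≤ B.t ∧ (x = B.la (B.n - i) ∨ x = B.lb (B.m + i - 1))) ∨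
    (∃ j : ℕ, j < B.w ∧ (x = B.la (B.n + j) ∨ x = B.lc (B.l - j - 1))) ∨
    (∃ h : ℕ, 1 ≤ h ∧ h ≤ B.v ∧ (x = B.lb (B.m - h) ∨ x = B.lc (B.l + h - 1))) := by
  have := B.tvw
  rcases x with ⟨_ | _ | _, x⟩
  · change ZMod (2 * B.p) at x
    have hk := ZMod.val_lt (B.n - 1 - x : ZMod (2 * B.p))
    have hx := ZMod.natCast_zmod_val (B.n - 1 - x : ZMod (2 * B.p))
    set k := ZMod.val (B.n - 1 - x : ZMod (2 * B.p))
    by_cases h : k < B.t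
    · refine Or.inl ⟨k + 1, by omega, by omega, Or.inl ?_⟩
      refine congrArg B.la ?_; push_cast; rw [hx]; ring
    · refine Or.inr (Or.inl ⟨2 * B.p - (k + 1), by omega, Or.inl ?_⟩)
      refine congrArg B.la ?_; rw [Nat.cast_sub (by omega), ZMod.natCast_self]; push_cast; rw [hx]; ring
  · change ZMod (2 * B.q) at x
    have hk := ZMod.val_lt (x - B.m : ZMod (2 * B.q))
    have hx := ZMod.natCast_zmod_val (x - B.m : ZMod (2 * B.q))
    set k := ZMod.val (x - B.m : ZMod (2 * B.q))
    by_cases h : k < B.t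
    · refine Or.inl ⟨k + 1, by omega, by omega, Or.inr ?_⟩
      refine congrArg B.lb ?_; push_cast; rw [hx]; ring
    · refine Or.inr (Or.inr ⟨2 * B.q - k, by omega, by omega, Or.inl ?_⟩)
      refine congrArg B.lb ?_; rw [Nat.cast_sub (by omega), ZMod.natCast_self, hx]; ring
  · change ZMod (2 * B.s) at x
    have hk := ZMod.val_lt (x - B.l : ZMod (2 * B.s))
    have hx := ZMod.natCast_zmod_val (x - B.l : ZMod (2 * B.s))
    set k := ZMod.val (x - B.l : ZMod (2 * B.s))
    by_cases h : k < B.v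
    · refine Or.inr (Or.inr ⟨k + 1, by omega, by omega, Or.inr ?_⟩)
      refine congrArg B.lc ?_; push_cast; rw [hx]; ring
    · refine Or.inr (Or.inl ⟨2 * B.s - (k + 1), by omega, Or.inr ?_⟩)
      refine congrArg B.lc ?_; rw [Nat.cast_sub (by omega), ZMod.natCast_self]; push_cast; rw [hx]; ring

theorem phiFun_phiFun (x : B.Label) : B.phiFun (B.phiFun x) = x := by
  rcases B.label_cases x with ⟨i, h1, h2, rfl | rfl⟩ | ⟨j, h1, rfl | rfl⟩ | ⟨h, h1, h2, rfl | rfl⟩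
  · rw [(B.phiFun_ab i h1 h2).1, (B.phiFun_ab i h1 h2).2]
  · rw [(B.phiFun_ab i h1 h2).2, (B.phiFun_ab i h1 h2).1]
  · rw [(B.phiFun_ac j h1).1, (B.phiFun_ac j h1).2]
  · rw [(B.phiFun_ac j h1).2, (B.phiFun_ac j h1).1]
  · rw [(B.phiFun_bc h h1 h2).1, (B.phiFun_bc h h1 h2).2]
  · rw [(B.phiFun_bc h h1 h2).2, (B.phiFun_bc h h1 h2).1]

/-- The permutation `φ` given by the arcs that connect the three butterflies. -/
def phi : Equiv.Perm B.Label := Function.Involutive.toPerm B.phiFun B.phiFun_phiFun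

theorem phi_ab (i : ℕ) (h1 : 1 ≤ i) (h2 : i ≤ B.t) :
    B.phi (B.la (B.n - i)) = B.lb (B.m + i - 1) := (B.phiFun_ab i h1 h2).1

theorem phi_ac (j : ℕ) (hj : j < B.w) :
    B.phi (B.la (B.n + j)) = B.lc (B.l - j - 1) := (B.phiFun_ac j hj).1

theorem phi_bc (h : ℕ) (h1 : 1 ≤ h) (h2 : h ≤ B.v) :
    B.phi (B.lb (B.m - h)) = B.lc (B.l + h - 1) := (B.phiFun_bc h h1 h2).1

theorem phi_phi (x : B.Label) : B.phi (B.phi x) = x := B.phiFun_phiFun x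

theorem phi_fst_ne (x : B.Label) : (B.phi x).1 ≠ x.1 := by
  change (B.phiFun x).1 ≠ x.1
  rcases x with ⟨_ | _ | _, x⟩ <;> simp only [phiFun, phiA, phiB, phiC] <;> split_ifs <;> simp

/-- The permutation `μ = φγ` (first `γ`, then `φ`). -/
def mu : Equiv.Perm B.Label := B.phi * B.gamma

/-- The set `E` of the endpoints of the bridges. -/
def E : Set B.Label :=
  {B.la 0, B.la (B.p : ZMod (2 * B.p)), B.lb 0, B.lb (B.q : ZMod (2 * B.q)),
    B.lc 0, B.lc (B.s : ZMod (2 * B.s))}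

/-! ## The canonical diagram of a 3-butterfly

Each bridge `β` is a straight segment with endpoints `β_0` and `β_len`, cut in `len β` parts. At
the `i`-th interior division point, `0 < i < len β`, an underarc crosses below the bridge from `β_i`
to `β_{-i}`. The labels run counterclockwise around the bridge, so at this crossing one meets, in
counterclockwise order, the underarc end at `β_i`, the part of the bridge towards `β_len`, the
underarc end at `β_{-i}`, and the part of the bridge towards `β_0`. Outside the bridges, the label
`x` is connected by an arc with the label `φ x`. -/

/-- The crossings of the canonical diagram: interior division points of the bridges. -/
abbrev Crossing : Type := (β : BridgeName) × Set.Ioo 0 (B.len β)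

/-- The strand end reached when one arrives from outside at the label `x`: at a bridge endpoint,
this is the bridge at its first crossing, and otherwise it is the underarc at its crossing with the
bridge. -/
def attach (x : B.Label) : B.Crossing × Fin 4 :=
  have h2 := B.two_le_len x.1
  have hv := ZMod.val_lt x.2
  if h0 : x.2.val = 0 then (⟨x.1, 1, by constructor <;> omega⟩, 3)
  else if h1 : x.2.val < B.len x.1 then (⟨x.1, x.2.val, by constructor <;> omega⟩, 0)
  else if h2 : x.2.val = B.len x.1 then (⟨x.1, B.len x.1 - 1, by constructor <;> omega⟩, 1)
  else (⟨x.1, 2 * B.len x.1 - x.2.val, by constructor <;> omega⟩, 2)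

/-- Running outwards from a strand end of a crossing, one either stays on the same bridge and
arrives at the neighbouring crossing, or leaves through a label `x` along the arc to `φ x`. -/
def joinFun : B.Crossing × Fin 4 → B.Crossing × Fin 4
  | (⟨β, i⟩, 0) => B.attach (B.phi ⟨β, (i : ℕ)⟩)
  | (⟨β, i⟩, 1) =>
      if h : i + 1 < B.len β then (⟨β, i + 1, Nat.succ_pos _, h⟩, 3)
      else B.attach (B.phi ⟨β, (B.len β : ℕ)⟩)
  | (⟨β, i⟩, 2) => B.attach (B.phi ⟨β, -(i : ℕ)⟩)
  | (⟨β, i⟩, 3) =>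
      if h : 1 < (i : ℕ) then (⟨β, i - 1, by omega, by have := i.2.2; omega⟩, 1)
      else B.attach (B.phi ⟨β, 0⟩)

theorem joinFun_attach (x : B.Label) : B.joinFun (B.attach x) = B.attach (B.phi x) := by
  obtain ⟨β, x⟩ := x
  have h2 := B.two_le_len β
  have hv := ZMod.val_lt x
  have hx := ZMod.natCast_zmod_val x
  generalize hy : B.attach (B.phi ⟨β, x⟩) = y
  unfold attach
  simp only
  split_ifs with a1 a2 a3
  · simp only [joinFun]
    rw [dif_neg (by simp), ← hy, (ZMod.val_eq_zero x).1 a1]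
  · simp only [joinFun]
    rw [hx, hy]
  · simp only [joinFun]
    rw [dif_neg (by omega), ← hy, show ((B.len β : ℕ) : ZMod (2 * B.len β)) = x from by
      rw [← hx]; exact congrArg _ a3.symm]
  · simp only [joinFun]
    rw [Nat.cast_sub (by omega), ZMod.natCast_self, hx, zero_sub, neg_neg, hy]

/-- Every strand end is attached to a label or lies in the middle of a bridge. -/
theorem dart_cases (d : B.Crossing × Fin 4) :
    (∃ x, d = B.attach x) ∨
    ∃ (β : BridgeName) (i : ℕ) (h : 0 < i) (h' : i + 1 < B.len β),
      d = (⟨β, i, h, by omega⟩, 1) ∨ d = (⟨β, i + 1, by omega, h'⟩, 3) := by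
  obtain ⟨⟨β, i, hi, hi'⟩, k⟩ := d
  have h2 := B.two_le_len β
  fin_cases k
  · refine Or.inl ⟨⟨β, (i : ℕ)⟩, ?_⟩
    have : ((i : ℕ) : ZMod (2 * B.len β)).val = i := ZMod.val_natCast_of_lt (by omega)
    simp only [attach, this]
    rw [dif_neg (by omega), dif_pos hi']; rfl
  · by_cases h : i + 1 < B.len β
    · exact Or.inr ⟨β, i, hi, h, Or.inl rfl⟩
    · refine Or.inl ⟨⟨β, (B.len β : ℕ)⟩, ?_⟩
      have : ((B.len β : ℕ) : ZMod (2 * B.len β)).val = B.len β :=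
        ZMod.val_natCast_of_lt (by omega)
      simp only [attach, this]
      rw [dif_neg (by omega), dif_neg (by omega), dif_pos trivial]
      obtain rfl : i = B.len β - 1 := by omega
      rfl
  · refine Or.inl ⟨⟨β, -(i : ℕ)⟩, ?_⟩
    have : (-((i : ℕ) : ZMod (2 * B.len β))).val = 2 * B.len β - i :=
      val_neg_natCast (by omega) (by omega)
    simp only [attach, this]
    rw [dif_neg (by omega), dif_neg (by omega), dif_neg (by omega)]
    have e : 2 * B.len β - (2 * B.len β - i) = i := by omega
    simp only [e]; rfl
  · by_cases h : 1 < i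
    · obtain ⟨j, rfl⟩ : ∃ j, i = j + 1 := ⟨i - 1, by omega⟩
      exact Or.inr ⟨β, j, by omega, hi', Or.inr rfl⟩
    · refine Or.inl ⟨⟨β, 0⟩, ?_⟩
      simp only [attach, ZMod.val_zero]
      rw [dif_pos trivial]
      obtain rfl : i = 1 := by omega
      rfl

theorem attach_fst (x : B.Label) : (B.attach x).1.1 = x.1 := by
  unfold attach
  simp only
  split_ifs <;> rfl

/-- The canonical diagram of the 3-butterfly. -/
def diagram : LinkDiagram where
  Crossing := B.Crossing
  finite_crossing := inferInstance
  join := B.joinFun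
  join_join d := by
    rcases B.dart_cases d with ⟨x, rfl⟩ | ⟨β, i, h, h', rfl | rfl⟩
    · rw [joinFun_attach, joinFun_attach, phi_phi]
    · simp only [joinFun]; rw [dif_pos h']; simp [h]
    · simp only [joinFun]; rw [dif_pos (by omega)]; simp [h']
  join_ne d := by
    rcases B.dart_cases d with ⟨x, rfl⟩ | ⟨β, i, h, h', rfl | rfl⟩
    · rw [joinFun_attach]
      intro e
      have := congrArg (fun d => d.1.1) e
      simp only [attach_fst] at this
      exact B.phi_fst_ne x this
    · simp only [joinFun]; rw [dif_pos h']; simp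
    · simp only [joinFun]; rw [dif_pos (by omega)]; simp

/-- A 3-butterfly is reduced if its diagram is a 3-bridge diagram without trivial components. -/
def IsReduced : Prop := B.diagram.numBridges = 3 ∧ ¬ B.diagram.HasTrivialComponent

/-- `(p/n, q/m, s/l)` is a Schubert form of a 3-bridge link. -/
def IsSchubertForm : Prop := B.IsReduced

end ThreeButterfly

/-! Running along a component of the diagram that stays below everything, one alternately crosses
under a segment, which changes the label by `γ`, and follows an arc, which changes it by `φ`. Such a
component therefore amounts to a cycle of `μ` avoiding `E`. No component runs only over, and each
segment is exactly one bridge, because the inequalities defining a 3-butterfly say that `φ` joins no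
two elements of `E`. Hence the butterfly is reduced if and only if every cycle of `μ` meets `E`.

Now `E` is the set of fixed points of `γ`, and `γ` conjugates `μ` to its inverse. So `γ` reflects
every cycle of `μ` through an element of `E`; the length of the cycle is even since `φ` has no fixed
points, and the reflection then fixes exactly two of its elements. As `E` has six elements, three
cycles meet it. -/

section Involutions

variable {α : Type*} {γ φ : Equiv.Perm α} {e : α}

theorem involutive_apply_zpow_mul_apply (hγ : Function.Involutive γ) (hφ : Function.Involutive φ)
    (k : ℤ) (x : α) : γ (((φ * γ) ^ k) x) = ((φ * γ) ^ (-k)) (γ x) := by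
  have hγγ : γ * γ = 1 := Equiv.ext hγ
  have hφφ : φ * φ = 1 := Equiv.ext hφ
  have hconj : SemiconjBy γ (φ * γ) (φ * γ)⁻¹ := by
    rw [SemiconjBy, mul_inv_rev, inv_eq_of_mul_eq_one_left hγγ, inv_eq_of_mul_eq_one_left hφφ,
      mul_assoc]
  have h := (hconj.zpow_right k).eq
  rw [inv_zpow'] at h
  exact Equiv.congr_fun h x

theorem sameCycle_mul_involutive_apply_iff (hγ : Function.Involutive γ)
    (hφ : Function.Involutive φ) (he : γ e = e) {x : α} :
    (φ * γ).SameCycle e (γ x) ↔ (φ * γ).SameCycle e x := by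
  have imp {y : α} : (φ * γ).SameCycle e y → (φ * γ).SameCycle e (γ y) := by
    rintro ⟨k, rfl⟩
    exact ⟨-k, by rw [involutive_apply_zpow_mul_apply hγ hφ, he]⟩
  exact ⟨fun h => by simpa only [hγ x] using imp h, imp⟩

theorem sameCycle_involutive_mul_apply_iff (hγ : Function.Involutive γ)
    (hφ : Function.Involutive φ) (he : γ e = e) {x : α} :
    (φ * γ).SameCycle e (φ x) ↔ (φ * γ).SameCycle e x := by
  have hφx : φ x = (φ * γ) (γ x) := by rw [Equiv.Perm.mul_apply, hγ]
  rw [hφx, Equiv.Perm.sameCycle_apply_right, sameCycle_mul_involutive_apply_iff hγ hφ he]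

theorem zpow_apply_eq_zpow_apply_iff_minimalPeriod_dvd (f : Equiv.Perm α) (x : α) (a b : ℤ) :
    (f ^ a) x = (f ^ b) x ↔ (Function.minimalPeriod f x : ℤ) ∣ a - b := by
  have hab : f ^ a = f ^ b * f ^ (a - b) := by rw [← zpow_add, add_sub_cancel]
  rw [hab, Equiv.Perm.mul_apply, (f ^ b).injective.eq_iff]
  exact MulAction.zpow_smul_eq_iff_minimalPeriod_dvd (a := f) (b := x)

theorem involutive_apply_zpow_mul_eq_self_iff (hγ : Function.Involutive γ)
    (hφ : Function.Involutive φ) (he : γ e = e) (k : ℤ) :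
    γ (((φ * γ) ^ k) e) = ((φ * γ) ^ k) e ↔
      (Function.minimalPeriod (φ * γ) e : ℤ) ∣ 2 * k := by
  rw [involutive_apply_zpow_mul_apply hγ hφ, he, zpow_apply_eq_zpow_apply_iff_minimalPeriod_dvd,
    ← dvd_neg]
  ring_nf

-- An odd period `2 * h + 1` would make `((φ * γ) ^ (h + 1)) e` a fixed point of `φ`.
theorem even_minimalPeriod_mul_of_involutive (hγ : Function.Involutive γ)
    (hφ : Function.Involutive φ) (hφ_ne : ∀ x, φ x ≠ x) (he : γ e = e) :
    Even (Function.minimalPeriod (φ * γ) e) := by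
  by_contra hodd
  obtain ⟨h, hh⟩ := Nat.not_even_iff_odd.1 hodd
  apply hφ_ne (((φ * γ) ^ (h + 1 : ℤ)) e)
  calc φ (((φ * γ) ^ (h + 1 : ℤ)) e)
      = (φ * γ) (γ (((φ * γ) ^ (h + 1 : ℤ)) e)) := by rw [Equiv.Perm.mul_apply, hγ]
    _ = ((φ * γ) ^ (-h : ℤ)) e := by
        rw [involutive_apply_zpow_mul_apply hγ hφ, he, ← Equiv.Perm.mul_apply, ← zpow_one_add]
        congr 2
        ring
    _ = ((φ * γ) ^ (h + 1 : ℤ)) e := by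
        rw [zpow_apply_eq_zpow_apply_iff_minimalPeriod_dvd, hh]
        exact ⟨-1, by push_cast; ring⟩

theorem sameCycle_mul_inter_fixedPoints_eq_pair (hγ : Function.Involutive γ)
    (hφ : Function.Involutive φ) (he : γ e = e) {h : ℕ}
    (hh : Function.minimalPeriod (φ * γ) e = 2 * h) :
    {x | (φ * γ).SameCycle e x} ∩ Function.fixedPoints γ = {e, ((φ * γ) ^ (h : ℤ)) e} := by
  have fixed_iff (k : ℤ) : γ (((φ * γ) ^ k) e) = ((φ * γ) ^ k) e ↔ (h : ℤ) ∣ k := by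
    rw [involutive_apply_zpow_mul_eq_self_iff hγ hφ he, hh, Nat.cast_mul,
      Nat.cast_ofNat, Int.mul_dvd_mul_iff_left two_ne_zero]
  ext x
  constructor
  · rintro ⟨⟨k, rfl⟩, hk⟩
    obtain ⟨c, rfl⟩ := (fixed_iff k).1 hk
    obtain ⟨d, rfl | rfl⟩ := Int.even_or_odd' c
    · left
      refine (zpow_apply_eq_zpow_apply_iff_minimalPeriod_dvd (φ * γ) e _ 0).2 ?_
      rw [hh]
      exact ⟨d, by push_cast; ring⟩
    · right
      rw [Set.mem_singleton_iff, zpow_apply_eq_zpow_apply_iff_minimalPeriod_dvd, hh]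
      exact ⟨d, by push_cast; ring⟩
  · rintro (rfl | rfl)
    · exact ⟨.refl _ _, he⟩
    · exact ⟨⟨h, rfl⟩, (fixed_iff h).2 dvd_rfl⟩

theorem ncard_sameCycle_mul_inter_fixedPoints (hγ : Function.Involutive γ)
    (hφ : Function.Involutive φ) (hφ_ne : ∀ x, φ x ≠ x) (he : γ e = e)
    (he_per : e ∈ Function.periodicPts (φ * γ)) :
    ({x | (φ * γ).SameCycle e x} ∩ Function.fixedPoints γ).ncard = 2 := by
  obtain ⟨h, hh⟩ := (even_minimalPeriod_mul_of_involutive hγ hφ hφ_ne he).two_dvd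
  have hpos := Function.minimalPeriod_pos_of_mem_periodicPts he_per
  rw [sameCycle_mul_inter_fixedPoints_eq_pair hγ hφ he hh, Set.ncard_pair]
  intro heq
  have hdvd := (zpow_apply_eq_zpow_apply_iff_minimalPeriod_dvd (φ * γ) e h 0).1 heq.symm
  rw [hh, sub_zero, Int.natCast_dvd_natCast] at hdvd
  have := Nat.le_of_dvd (by lia) hdvd
  lia

end Involutions

section CycleFactors

theorem injective_of_disjoint_cycles {α ι : Type*} {τ : ι → Equiv.Perm α}
    (hcycle : ∀ i, (τ i).IsCycle) (hdisj : ∀ i j, i ≠ j → (τ i).Disjoint (τ j)) :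
    Function.Injective τ := by
  intro i j hij
  by_contra hne
  exact (hcycle j).ne_one (Equiv.Perm.disjoint_refl_iff.1 (hij ▸ hdisj i j hne))

theorem setOf_cycleOf_apply_ne {α : Type*} {f : Equiv.Perm α} [DecidableRel f.SameCycle] {x : α}
    (hx : f x ≠ x) : {y | f.cycleOf x y ≠ y} = {y | f.SameCycle x y} := by
  ext y
  rw [Set.mem_ofPred_eq, Set.mem_ofPred_eq, Equiv.Perm.cycleOf_apply]
  split_ifs with hxy
  · exact iff_of_true (hxy.apply_eq_self_iff.not.1 hx) hxy
  · exact iff_of_false (not_not_intro rfl) hxy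

variable {α : Type*} [Fintype α] [DecidableEq α] {f : Equiv.Perm α}

theorem cycleFactorsFinset_eq_image_iff {n : ℕ} {τ : Fin n → Equiv.Perm α}
    (hτ : Function.Injective τ) :
    f.cycleFactorsFinset = Finset.univ.image τ ↔
      (∀ i, (τ i).IsCycle) ∧ (∀ i j, i ≠ j → (τ i).Disjoint (τ j)) ∧ f = (List.ofFn τ).prod := by
  have himage : Finset.univ.image τ = (List.ofFn τ).toFinset := by
    ext
    simp only [Finset.mem_image, Finset.mem_univ, true_and, List.mem_toFinset, List.mem_ofFn]
  rw [himage, Equiv.Perm.cycleFactorsFinset_eq_list_toFinset (List.nodup_ofFn.2 hτ),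
    List.forall_mem_ofFn_iff, List.pairwise_ofFn, eq_comm (a := f)]
  refine and_congr_right' (and_congr_left' ⟨fun h i j hij => ?_, fun h i j hij => h i j hij.ne⟩)
  exact hij.lt_or_gt.elim (fun hlt => h hlt) fun hgt => (h hgt).symm

theorem card_cycleFactorsFinset_eq_and_forall_iff {n : ℕ} {P : Equiv.Perm α → Prop} :
    (f.cycleFactorsFinset.card = n ∧ ∀ c ∈ f.cycleFactorsFinset, P c) ↔
      ∃ τ : Fin n → Equiv.Perm α,
        (∀ i, (τ i).IsCycle) ∧ (∀ i j, i ≠ j → (τ i).Disjoint (τ j)) ∧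
          f = (List.ofFn τ).prod ∧ ∀ i, P (τ i) := by
  constructor
  · rintro ⟨hcard, hP⟩
    let ε := (Finset.equivFinOfCardEq hcard).symm
    have himage : f.cycleFactorsFinset = Finset.univ.image fun i => (ε i : Equiv.Perm α) := by
      ext c
      simp only [Finset.mem_image, Finset.mem_univ, true_and]
      exact ⟨fun hc => ⟨ε.symm ⟨c, hc⟩, by rw [ε.apply_symm_apply]⟩, fun ⟨i, hi⟩ => hi ▸ (ε i).2⟩
    obtain ⟨hcycle, hdisj, hprod⟩ := (cycleFactorsFinset_eq_image_iff
      (Subtype.val_injective.comp ε.injective)).1 himage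
    exact ⟨_, hcycle, hdisj, hprod, fun i => hP _ (ε i).2⟩
  · rintro ⟨τ, hcycle, hdisj, hprod, hP⟩
    have hinj := injective_of_disjoint_cycles hcycle hdisj
    rw [(cycleFactorsFinset_eq_image_iff hinj).2 ⟨hcycle, hdisj, hprod⟩]
    refine ⟨by rw [Finset.card_image_of_injective _ hinj, Finset.card_fin], ?_⟩
    simpa using hP

theorem card_cycleFactorsFinset_mul {E : Set α} {k : ℕ} (hE : ∀ e ∈ E, f e ≠ e)
    (hk : ∀ c ∈ f.cycleFactorsFinset, ({x | c x ≠ x} ∩ E).ncard = k) :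
    f.cycleFactorsFinset.card * k = E.ncard := by
  classical
  have fiber_card {c : Equiv.Perm α} (hc : c ∈ f.cycleFactorsFinset) :
      (E.toFinset.filter fun e => f.cycleOf e = c).card = k := by
    rw [← hk c hc, ← Set.ncard_coe_finset]
    congr 1
    ext e
    rw [Finset.mem_coe, Finset.mem_filter, Set.mem_toFinset, Set.mem_inter_iff, and_comm]
    refine and_congr_left fun he => ⟨?_, fun hce => ?_⟩
    · rintro rfl
      exact (f.cycleOf_apply_self e).trans_ne (hE e he)
    · exact (Equiv.Perm.cycle_is_cycleOf (Equiv.Perm.mem_support.2 hce) hc).symm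
  rw [Set.ncard_eq_toFinset_card', Finset.card_eq_sum_card_fiberwise (f := f.cycleOf)
    (t := f.cycleFactorsFinset), Finset.sum_const_nat fun c hc => fiber_card hc]
  intro e he
  rw [Finset.mem_coe, Set.mem_toFinset] at he
  exact Equiv.Perm.cycleOf_mem_cycleFactorsFinset_iff.2 (Equiv.Perm.mem_support.2 (hE e he))

end CycleFactors

theorem forall_exists_sameCycle_iff_exists_cycles {α : Type*} [Finite α] {f : Equiv.Perm α}
    {E : Set α} {n k : ℕ} (hk : k ≠ 0) (hE : ∀ e ∈ E, f e ≠ e) (hcard : E.ncard = n * k)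
    (hcycle : ∀ e ∈ E, ({x | f.SameCycle e x} ∩ E).ncard = k) :
    (∀ x, f x ≠ x → ∃ e ∈ E, f.SameCycle e x) ↔
      ∃ τ : Fin n → Equiv.Perm α,
        (∀ i, (τ i).IsCycle) ∧ (∀ i j, i ≠ j → (τ i).Disjoint (τ j)) ∧
          f = (List.ofFn τ).prod ∧ ∀ i, ({x | τ i x ≠ x} ∩ E).ncard = k := by
  classical
  have := Fintype.ofFinite α
  rw [← card_cycleFactorsFinset_eq_and_forall_iff
    (P := fun c => ({x | c x ≠ x} ∩ E).ncard = k)]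
  constructor
  · intro hmeet
    have hfactor : ∀ c ∈ f.cycleFactorsFinset, ({x | c x ≠ x} ∩ E).ncard = k := by
      intro c hc
      obtain ⟨hc_cycle, hc_apply⟩ := Equiv.Perm.mem_cycleFactorsFinset_iff.1 hc
      obtain ⟨x, hx⟩ := hc_cycle.nonempty_support
      obtain ⟨e, he, hex⟩ := hmeet x (hc_apply x hx ▸ Equiv.Perm.mem_support.1 hx)
      rw [Equiv.Perm.cycle_is_cycleOf hx hc, ← hex.cycleOf_eq, setOf_cycleOf_apply_ne (hE e he),
        hcycle e he]
    exact ⟨Nat.eq_of_mul_eq_mul_right (Nat.pos_of_ne_zero hk)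
      ((card_cycleFactorsFinset_mul hE hfactor).trans hcard), hfactor⟩
  · rintro ⟨-, hfactor⟩ x hx
    have hmem := Equiv.Perm.cycleOf_mem_cycleFactorsFinset_iff.2 (Equiv.Perm.mem_support.2 hx)
    have hcard_x := hfactor _ hmem
    rw [setOf_cycleOf_apply_ne hx] at hcard_x
    obtain ⟨e, hxe, he⟩ := Set.nonempty_of_ncard_ne_zero (hcard_x.trans_ne hk)
    exact ⟨e, he, hxe.symm⟩

namespace LinkDiagram

variable {D : LinkDiagram}

theorem not_isOver_iff_isUnder (d : D.Crossing × Fin 4) : ¬ D.IsOver d ↔ D.IsUnder d := by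
  obtain ⟨x, k⟩ := d
  fin_cases k <;> simp [IsOver, IsUnder]

theorem sameComponent_equivalence (D : LinkDiagram) : Equivalence D.SameComponent :=
  Relation.EqvGen.is_equivalence _

theorem sameComponent_join (d : D.Crossing × Fin 4) : D.SameComponent d (D.join d) :=
  .rel _ _ (.inl rfl)

theorem sameComponent_opposite (d : D.Crossing × Fin 4) : D.SameComponent d (d.1, d.2 + 2) :=
  .rel _ _ (.inr rfl)

theorem SameComponent.mem_of_forall_mem {S : Set (D.Crossing × Fin 4)}
    (hjoin : ∀ d ∈ S, D.join d ∈ S) (hopposite : ∀ d ∈ S, (d.1, d.2 + 2) ∈ S)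
    {d d' : D.Crossing × Fin 4} (h : D.SameComponent d d') (hd : d ∈ S) : d' ∈ S := by
  suffices hle : Relation.EqvGen.setoid (fun d d' => d' = D.join d ∨ d' = (d.1, d.2 + 2)) ≤
      Setoid.ker (· ∈ S) from (hle h : (d ∈ S) = (d' ∈ S)).mp hd
  refine Setoid.eqvGen_le fun d d' h => propext ?_
  rcases h with rfl | rfl
  · exact ⟨hjoin d, fun h => D.join_join d ▸ hjoin _ h⟩
  · have hopposite_opposite : (d.1, d.2 + 2 + 2) = d := by
      rw [add_assoc]
      exact Prod.ext rfl (add_zero d.2)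
    exact ⟨hopposite d, fun h => hopposite_opposite ▸ hopposite _ h⟩

theorem sameComponent_of_isOver {x : D.Crossing} {i j : Fin 4} (hi : D.IsOver (x, i))
    (hj : D.IsOver (x, j)) : D.SameComponent (x, i) (x, j) := by
  rcases hi with rfl | rfl <;> rcases hj with rfl | rfl
  exacts [.refl _, sameComponent_opposite _, sameComponent_opposite _, .refl _]

theorem sameComponent_of_bridgeSetoid {x y : D.Crossing} (h : D.bridgeSetoid x y) :
    D.SameComponent (x, 1) (y, 1) := by
  let overSetoid : Setoid D.Crossing :=
    ⟨fun x y => D.SameComponent (x, 1) (y, 1), D.sameComponent_equivalence.comap (·, 1)⟩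
  refine (Setoid.eqvGen_le (s := overSetoid) ?_ : D.bridgeSetoid ≤ overSetoid) h
  rintro x y ⟨i, j, hi, hj, hij⟩
  have hjoin := sameComponent_join (x, i)
  rw [hij] at hjoin
  exact D.sameComponent_equivalence.trans (sameComponent_of_isOver (.inl rfl) hi)
    (D.sameComponent_equivalence.trans hjoin (sameComponent_of_isOver hj (.inl rfl)))

end LinkDiagram

theorem card_bridgeName : Nat.card BridgeName = 3 := by
  let ε : BridgeName ≃ Fin 3 :=
    { toFun := fun | .a => 0 | .b => 1 | .c => 2
      invFun := ![.a, .b, .c]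
      left_inv := by rintro (_ | _ | _) <;> rfl
      right_inv := by intro i; fin_cases i <;> rfl }
  rw [Nat.card_congr ε, Nat.card_fin]

namespace ThreeButterfly

variable {B : ThreeButterfly}

section Endpoints

theorem gamma_mk (β : BridgeName) (x : ZMod (2 * B.len β)) : B.gamma ⟨β, x⟩ = ⟨β, -x⟩ := rfl

theorem gamma_involutive : Function.Involutive B.gamma := fun x => by
  rw [gamma_mk, gamma_mk, neg_neg]

theorem phi_involutive : Function.Involutive B.phi := B.phi_phi

theorem mu_apply_ne (x : B.Label) : B.mu x ≠ x :=
  fun h => B.phi_fst_ne (B.gamma x) (show (B.mu x).1 = x.1 from congrArg Sigma.fst h)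

/-- The endpoints of the bridges, indexed by the bridge and its end: `β_0` for `false` and `β_len`
for `true`. -/
def endpoint (B : ThreeButterfly) (i : BridgeName × Bool) : B.Label :=
  ⟨i.1, if i.2 then (B.len i.1 : ℕ) else 0⟩

theorem range_endpoint : Set.range B.endpoint = B.E := by
  ext x
  constructor
  · rintro ⟨⟨_ | _ | _, _ | _⟩, rfl⟩
    exacts [.inl rfl, .inr (.inl rfl), .inr (.inr (.inl rfl)), .inr (.inr (.inr (.inl rfl))),
      .inr (.inr (.inr (.inr (.inl rfl)))), .inr (.inr (.inr (.inr (.inr rfl))))]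
  · rintro (rfl | rfl | rfl | rfl | rfl | rfl)
    exacts [⟨(.a, false), rfl⟩, ⟨(.a, true), rfl⟩, ⟨(.b, false), rfl⟩, ⟨(.b, true), rfl⟩,
      ⟨(.c, false), rfl⟩, ⟨(.c, true), rfl⟩]

theorem val_natCast_len (β : BridgeName) :
    ((B.len β : ℕ) : ZMod (2 * B.len β)).val = B.len β :=
  ZMod.val_natCast_of_lt (by have := B.two_le_len β; lia)

theorem endpoint_injective : Function.Injective B.endpoint := by
  have hlen (β : BridgeName) : ((B.len β : ℕ) : ZMod (2 * B.len β)) ≠ 0 := by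
    rw [Ne, ← ZMod.val_eq_zero, val_natCast_len]
    have := B.two_le_len β
    lia
  rintro ⟨β, b⟩ ⟨β', b'⟩ h
  obtain rfl : β = β' := congrArg Sigma.fst h
  have hsnd := eq_of_heq (Sigma.mk.inj h).2
  cases b <;> cases b'
  exacts [rfl, absurd hsnd.symm (hlen β), absurd hsnd (hlen β), rfl]

theorem ncard_E : B.E.ncard = 6 := by
  rw [← range_endpoint, ← Nat.card_coe_set_eq, Nat.card_range_of_injective endpoint_injective,
    Nat.card_prod, card_bridgeName, Nat.card_eq_fintype_card, Fintype.card_bool]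

theorem mk_mem_E_iff {β : BridgeName} {x : ZMod (2 * B.len β)} :
    (⟨β, x⟩ : B.Label) ∈ B.E ↔ x = 0 ∨ x = (B.len β : ℕ) := by
  rw [← range_endpoint]
  constructor
  · rintro ⟨⟨β, _ | _⟩, h⟩ <;> cases h
    exacts [.inl rfl, .inr rfl]
  · rintro (rfl | rfl)
    exacts [⟨(β, false), rfl⟩, ⟨(β, true), rfl⟩]

theorem fixedPoints_gamma : Function.fixedPoints B.gamma = B.E := by
  ext ⟨β, x⟩
  rw [Function.mem_fixedPoints_iff, gamma_mk, Sigma.mk.injEq, heq_eq_eq, and_iff_right rfl,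
    ZMod.neg_eq_self_iff, mk_mem_E_iff]
  refine or_congr_right ⟨fun h => ?_, ?_⟩
  · exact (ZMod.natCast_zmod_val x).symm.trans (congrArg _ (Nat.eq_of_mul_eq_mul_left two_pos h))
  · rintro rfl
    rw [val_natCast_len]

theorem gamma_eq_self {e : B.Label} (he : e ∈ B.E) : B.gamma e = e := by
  rwa [← fixedPoints_gamma] at he

theorem intCast_mem_E_iff {β : BridgeName} {z : ℤ} :
    (⟨β, z⟩ : B.Label) ∈ B.E ↔ (B.len β : ℤ) ∣ z := by
  rw [← fixedPoints_gamma, Function.mem_fixedPoints_iff, gamma_mk, Sigma.mk.injEq, heq_eq_eq,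
    and_iff_right rfl, neg_eq_iff_add_eq_zero, ← Int.cast_add, ZMod.intCast_zmod_eq_zero_iff_dvd,
    Nat.cast_mul, Nat.cast_ofNat, ← two_mul, Int.mul_dvd_mul_iff_left two_ne_zero]

end Endpoints

section Arcs

theorem eq_zero_or_eq_of_dvd {a z : ℤ} (h : a ∣ z) (hneg : -a < z) (hlt : z < 2 * a) :
    z = 0 ∨ z = a := by
  obtain ⟨c, rfl⟩ := h
  have ha : 0 < a := by lia
  have : -1 < c := lt_of_mul_lt_mul_left (by lia) ha.le
  have : c < 2 := lt_of_mul_lt_mul_left (by lia) ha.le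
  obtain rfl | rfl : c = 0 ∨ c = 1 := by lia
  · exact .inl (mul_zero a)
  · exact .inr (mul_one a)

theorem la_notMem_E_or_lb_notMem_E {i : ℕ} (hi : 1 ≤ i) (hit : i ≤ B.t) :
    B.la (B.n - i) ∉ B.E ∨ B.lb (B.m + i - 1) ∉ B.E := by
  by_contra! ⟨ha, hb⟩
  have hp : (B.p : ℤ) ∣ B.n - i := (intCast_mem_E_iff (β := .a)).1 (by push_cast; exact ha)
  have hq : (B.q : ℤ) ∣ B.m + i - 1 := (intCast_mem_E_iff (β := .b)).1 (by push_cast; exact hb)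
  obtain ⟨p, n, q, m, s, l, _, _, _, _, _, _, _, _, _, _, _, _⟩ := B
  simp only [t] at *
  have hp' := eq_zero_or_eq_of_dvd (dvd_neg.2 hp) (by lia) (by lia)
  have hq' := eq_zero_or_eq_of_dvd (dvd_sub_self_right.2 hq) (by lia) (by lia)
  lia

theorem la_notMem_E_or_lc_notMem_E {j : ℕ} (hjw : j < B.w) :
    B.la (B.n + j) ∉ B.E ∨ B.lc (B.l - j - 1) ∉ B.E := by
  by_contra! ⟨ha, hc⟩
  have hp : (B.p : ℤ) ∣ B.n + j := (intCast_mem_E_iff (β := .a)).1 (by push_cast; exact ha)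
  have hs : (B.s : ℤ) ∣ B.l - j - 1 := (intCast_mem_E_iff (β := .c)).1 (by push_cast; exact hc)
  obtain ⟨p, n, q, m, s, l, _, _, _, _, _, _, _, _, _, _, _, _⟩ := B
  simp only [w] at *
  have hp' := eq_zero_or_eq_of_dvd hp (by lia) (by lia)
  have hs' := eq_zero_or_eq_of_dvd (dvd_neg.2 hs) (by lia) (by lia)
  lia

theorem lb_notMem_E_or_lc_notMem_E {h : ℕ} (hh : 1 ≤ h) (hhv : h ≤ B.v) :
    B.lb (B.m - h) ∉ B.E ∨ B.lc (B.l + h - 1) ∉ B.E := by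
  by_contra! ⟨hb, hc⟩
  have hq : (B.q : ℤ) ∣ B.m - h := (intCast_mem_E_iff (β := .b)).1 (by push_cast; exact hb)
  have hs : (B.s : ℤ) ∣ B.l + h - 1 := (intCast_mem_E_iff (β := .c)).1 (by push_cast; exact hc)
  obtain ⟨p, n, q, m, s, l, _, _, _, _, _, _, _, _, _, _, _, _⟩ := B
  simp only [v] at *
  have hq' := eq_zero_or_eq_of_dvd (dvd_neg.2 hq) (by lia) (by lia)
  have hs' := eq_zero_or_eq_of_dvd (dvd_sub_self_right.2 hs) (by lia) (by lia)
  lia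

theorem phi_notMem_E {x : B.Label} (hx : x ∈ B.E) : B.phi x ∉ B.E := by
  suffices h : x ∉ B.E ∨ B.phi x ∉ B.E from h.resolve_left (not_not_intro hx)
  rcases B.label_cases x with
    ⟨i, hi, hit, rfl | rfl⟩ | ⟨j, hjw, rfl | rfl⟩ | ⟨h, hh, hhv, rfl | rfl⟩
  · rw [B.phi_ab i hi hit]
    exact la_notMem_E_or_lb_notMem_E hi hit
  · rw [← B.phi_ab i hi hit, phi_phi, B.phi_ab i hi hit]
    exact (la_notMem_E_or_lb_notMem_E hi hit).symm
  · rw [B.phi_ac j hjw]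
    exact la_notMem_E_or_lc_notMem_E hjw
  · rw [← B.phi_ac j hjw, phi_phi, B.phi_ac j hjw]
    exact (la_notMem_E_or_lc_notMem_E hjw).symm
  · rw [B.phi_bc h hh hhv]
    exact lb_notMem_E_or_lc_notMem_E hh hhv
  · rw [← B.phi_bc h hh hhv, phi_phi, B.phi_bc h hh hhv]
    exact (lb_notMem_E_or_lc_notMem_E hh hhv).symm

end Arcs

section Attach

theorem attach_zero (β : BridgeName) :
    B.attach ⟨β, 0⟩ = (⟨β, 1, one_pos, B.two_le_len β⟩, 3) := by
  simp only [attach, ZMod.val_zero, dite_true]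

theorem attach_len (β : BridgeName) :
    B.attach ⟨β, (B.len β : ℕ)⟩ =
      (⟨β, B.len β - 1, by have := B.two_le_len β; constructor <;> lia⟩, 1) := by
  have := B.two_le_len β
  simp only [attach, val_natCast_len]
  rw [dif_neg (by lia), dif_neg (by lia), dif_pos trivial]

theorem attach_natCast {β : BridgeName} {i : ℕ} (hi : i ∈ Set.Ioo 0 (B.len β)) :
    B.attach ⟨β, (i : ℕ)⟩ = (⟨β, i, hi⟩, 0) := by
  have hval : ((i : ℕ) : ZMod (2 * B.len β)).val = i :=
    ZMod.val_natCast_of_lt (by have := hi.2; lia)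
  simp only [attach, hval]
  rw [dif_neg hi.1.ne', dif_pos hi.2]

theorem attach_neg_natCast {β : BridgeName} {i : ℕ} (hi : i ∈ Set.Ioo 0 (B.len β)) :
    B.attach ⟨β, -(i : ℕ)⟩ = (⟨β, i, hi⟩, 2) := by
  obtain ⟨hpos, hlt⟩ := hi
  have hval : (-(i : ℕ) : ZMod (2 * B.len β)).val = 2 * B.len β - i :=
    val_neg_natCast hpos (by lia)
  have hsub : 2 * B.len β - (2 * B.len β - i) = i := by lia
  simp only [attach, hval]
  rw [dif_neg (by lia), dif_neg (by lia), dif_neg (by lia)]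
  simp only [hsub]

theorem exists_eq_natCast_or_eq_neg_natCast {x : B.Label} (hx : x ∉ B.E) :
    ∃ (β : BridgeName) (i : ℕ) (_ : i ∈ Set.Ioo 0 (B.len β)),
      x = ⟨β, (i : ℕ)⟩ ∨ x = ⟨β, -(i : ℕ)⟩ := by
  obtain ⟨β, x⟩ := x
  rw [mk_mem_E_iff, not_or] at hx
  have hx_val := ZMod.natCast_zmod_val x
  have hlt := ZMod.val_lt x
  have hne_zero : x.val ≠ 0 := fun h => hx.1 ((ZMod.val_eq_zero x).1 h)
  have hne_len : x.val ≠ B.len β := fun h => hx.2 (hx_val.symm.trans (congrArg _ h))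
  rcases hne_len.lt_or_gt with hside | hside
  · exact ⟨β, x.val, ⟨by lia, hside⟩, .inl (by rw [hx_val])⟩
  · refine ⟨β, 2 * B.len β - x.val, ⟨by lia, by lia⟩, .inr ?_⟩
    rw [Nat.cast_sub hlt.le, ZMod.natCast_self, hx_val, zero_sub, neg_neg]

theorem attach_gamma {x : B.Label} (hx : x ∉ B.E) :
    B.attach (B.gamma x) = ((B.attach x).1, (B.attach x).2 + 2) := by
  obtain ⟨β, i, hi, rfl | rfl⟩ := exists_eq_natCast_or_eq_neg_natCast hx
  · rw [gamma_mk, attach_natCast hi, attach_neg_natCast hi]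
    rfl
  · rw [gamma_mk, neg_neg, attach_natCast hi, attach_neg_natCast hi]
    rfl

theorem isOver_attach_iff {x : B.Label} : B.diagram.IsOver (B.attach x) ↔ x ∈ B.E := by
  refine ⟨fun h => ?_, fun hx => ?_⟩
  · by_contra hx
    revert h
    refine (LinkDiagram.not_isOver_iff_isUnder _).2 ?_
    obtain ⟨β, i, hi, rfl | rfl⟩ := exists_eq_natCast_or_eq_neg_natCast hx
    · exact .inl (by rw [attach_natCast hi])
    · exact .inr (by rw [attach_neg_natCast hi])
  · rcases mk_mem_E_iff.1 hx with h0 | hlen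
    · exact .inr (by rw [← Sigma.eta x, h0, attach_zero])
    · exact .inl (by rw [← Sigma.eta x, hlen, attach_len])

theorem isUnder_attach_iff {x : B.Label} : B.diagram.IsUnder (B.attach x) ↔ x ∉ B.E :=
  (LinkDiagram.not_isOver_iff_isUnder (D := B.diagram) (B.attach x)).symm.trans
    isOver_attach_iff.not

theorem exists_attach_eq_of_isUnder {d : B.Crossing × Fin 4} (hd : B.diagram.IsUnder d) :
    ∃ x, B.attach x = d := by
  obtain ⟨⟨β, i, hi⟩, k⟩ := d
  obtain rfl | rfl : k = 0 ∨ k = 2 := hd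
  exacts [⟨_, attach_natCast hi⟩, ⟨_, attach_neg_natCast hi⟩]

theorem diagram_join_attach (x : B.Label) :
    B.diagram.join (B.attach x) = B.attach (B.phi x) := B.joinFun_attach x

end Attach

section Bridges

theorem diagram_join_succ {β : BridgeName} {i : ℕ} (hi : i ∈ Set.Ioo 0 (B.len β))
    (hi' : i + 1 ∈ Set.Ioo 0 (B.len β)) :
    B.diagram.join ((⟨β, i, hi⟩, 1) : B.Crossing × Fin 4) =
      ((⟨β, i + 1, hi'⟩, 3) : B.Crossing × Fin 4) :=
  dif_pos hi'.2

theorem fst_join_of_isOver {d : B.Crossing × Fin 4} (hd : B.diagram.IsOver d)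
    (hd' : B.diagram.IsOver (B.diagram.join d)) : (B.diagram.join d).1.1 = d.1.1 := by
  rcases B.dart_cases d with ⟨x, rfl⟩ | ⟨β, i, hi, hi', rfl | rfl⟩
  · rw [diagram_join_attach, isOver_attach_iff] at hd'
    exact absurd hd' (phi_notMem_E (isOver_attach_iff.1 hd))
  · rw [diagram_join_succ ⟨hi, by lia⟩ ⟨by lia, hi'⟩]
  · have hsucc := diagram_join_succ (B := B) ⟨hi, by lia⟩ ⟨by lia, hi'⟩
    have hpred := (congrArg B.diagram.join hsucc).symm.trans (B.diagram.join_join _)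
    exact congrArg (fun d => d.1.1) hpred

theorem bridgeSetoid_one {β : BridgeName} {i : ℕ} (hi : i ∈ Set.Ioo 0 (B.len β)) :
    B.diagram.bridgeSetoid (⟨β, 1, one_pos, B.two_le_len β⟩ : B.Crossing)
      (⟨β, i, hi⟩ : B.Crossing) := by
  obtain ⟨hpos, hlt⟩ := hi
  induction i, hpos using Nat.le_induction with
  | base => exact .refl _
  | succ i hpos ih =>
    exact .trans _ _ _ (ih (by lia))
      (.rel _ _ ⟨1, 3, .inl rfl, .inr rfl, diagram_join_succ ⟨hpos, by lia⟩ _⟩)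

theorem bridgeSetoid_diagram :
    B.diagram.bridgeSetoid = Setoid.ker (fun x : B.Crossing => x.1) := by
  refine le_antisymm (Setoid.eqvGen_le ?_) ?_
  · rintro x y ⟨i, j, hi, hj, hij⟩
    have h := fst_join_of_isOver hi (hij ▸ hj)
    rw [hij] at h
    exact h.symm
  · rintro ⟨β, i, hi⟩ ⟨β', j, hj⟩ (rfl : β = β')
    exact .trans _ _ _ (.symm _ _ (bridgeSetoid_one hi)) (bridgeSetoid_one hj)

theorem numBridges_diagram : B.diagram.numBridges = 3 := by
  have hsurj : Function.Surjective (fun x : B.Crossing => x.1) :=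
    fun β => ⟨⟨β, 1, one_pos, B.two_le_len β⟩, rfl⟩
  rw [LinkDiagram.numBridges, bridgeSetoid_diagram, ← card_bridgeName]
  exact Nat.card_congr (Setoid.quotientKerEquivOfSurjective _ hsurj)

end Bridges

section Components

theorem not_forall_isOver (d : B.Crossing × Fin 4) :
    ¬ ∀ d', B.diagram.SameComponent d d' → B.diagram.IsOver d' := by
  intro hover
  obtain ⟨⟨β, i, hi⟩, k⟩ := d
  have hequiv := B.diagram.sameComponent_equivalence
  have hlen : B.diagram.SameComponent ((⟨β, i, hi⟩, k) : B.Crossing × Fin 4)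
      (B.attach ⟨β, (B.len β : ℕ)⟩) := by
    rw [attach_len]
    refine hequiv.trans (LinkDiagram.sameComponent_of_isOver (hover _ (.refl _)) (.inl rfl))
      (LinkDiagram.sameComponent_of_bridgeSetoid ?_)
    rw [bridgeSetoid_diagram]
    exact rfl
  have hphi := hequiv.trans hlen (LinkDiagram.sameComponent_join _)
  rw [diagram_join_attach] at hphi
  exact phi_notMem_E (isOver_attach_iff.1 (hover _ hlen)) (isOver_attach_iff.1 (hover _ hphi))

theorem sameComponent_attach_mu {x : B.Label} (hx : x ∉ B.E) :
    B.diagram.SameComponent (B.attach x) (B.attach (B.mu x)) := by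
  have hopposite : B.diagram.SameComponent (B.attach x) (B.attach (B.gamma x)) := by
    rw [attach_gamma hx]
    exact LinkDiagram.sameComponent_opposite (D := B.diagram) _
  have hjoin := LinkDiagram.sameComponent_join (D := B.diagram) (B.attach (B.gamma x))
  rw [diagram_join_attach] at hjoin
  exact B.diagram.sameComponent_equivalence.trans hopposite hjoin

theorem sameComponent_attach_mu_pow {x : B.Label}
    (hunder : ∀ d, B.diagram.SameComponent (B.attach x) d → B.diagram.IsUnder d) (k : ℕ) :
    B.diagram.SameComponent (B.attach x) (B.attach ((B.mu ^ k) x)) := by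
  induction k with
  | zero => exact .refl _
  | succ k ih =>
    rw [pow_succ', Equiv.Perm.mul_apply]
    exact B.diagram.sameComponent_equivalence.trans ih
      (sameComponent_attach_mu (isUnder_attach_iff.1 (hunder _ ih)))

theorem exists_attach_eq_of_sameComponent {x : B.Label}
    (hx : ∀ e ∈ B.E, ¬ B.mu.SameCycle e x) {d : B.Crossing × Fin 4}
    (hd : B.diagram.SameComponent (B.attach x) d) :
    ∃ y, (∀ e ∈ B.E, ¬ B.mu.SameCycle e y) ∧ B.attach y = d := by
  let S : Set (B.Crossing × Fin 4) := B.attach '' {y | ∀ e ∈ B.E, ¬ B.mu.SameCycle e y}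
  have hxS : B.attach x ∈ S := ⟨x, hx, rfl⟩
  refine LinkDiagram.SameComponent.mem_of_forall_mem (D := B.diagram) (S := S) ?_ ?_ hd hxS
  · rintro _ ⟨y, hy, rfl⟩
    refine ⟨B.phi y, fun e he => ?_, (diagram_join_attach y).symm⟩
    exact (sameCycle_involutive_mul_apply_iff gamma_involutive phi_involutive
      (gamma_eq_self he)).not.2 (hy e he)
  · rintro _ ⟨y, hy, rfl⟩
    refine ⟨B.gamma y, fun e he => ?_, attach_gamma fun h => hy y h (.refl _ _)⟩
    exact (sameCycle_mul_involutive_apply_iff gamma_involutive phi_involutive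
      (gamma_eq_self he)).not.2 (hy e he)

theorem forall_isUnder_iff {x : B.Label} :
    (∀ d, B.diagram.SameComponent (B.attach x) d → B.diagram.IsUnder d) ↔
      ∀ e ∈ B.E, ¬ B.mu.SameCycle e x := by
  constructor
  · intro hunder e he hex
    obtain ⟨k, -, hk⟩ := hex.symm.exists_pow_eq'
    have he_under := hunder _ (sameComponent_attach_mu_pow hunder k)
    rw [hk, isUnder_attach_iff] at he_under
    exact he_under he
  · intro hx d hd
    obtain ⟨y, hy, rfl⟩ := exists_attach_eq_of_sameComponent hx hd
    exact isUnder_attach_iff.2 fun h => hy y h (.refl _ _)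

theorem hasTrivialComponent_diagram_iff :
    B.diagram.HasTrivialComponent ↔ ∃ x, ∀ e ∈ B.E, ¬ B.mu.SameCycle e x := by
  constructor
  · rintro ⟨d, hunder | hover⟩
    · obtain ⟨x, rfl⟩ := exists_attach_eq_of_isUnder (hunder d (.refl _))
      exact ⟨x, forall_isUnder_iff.1 hunder⟩
    · exact absurd hover (not_forall_isOver d)
  · rintro ⟨x, hx⟩
    exact ⟨B.attach x, .inl (forall_isUnder_iff.2 hx)⟩

theorem isSchubertForm_iff :
    B.IsSchubertForm ↔ ∀ x, B.mu x ≠ x → ∃ e ∈ B.E, B.mu.SameCycle e x := by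
  rw [IsSchubertForm, IsReduced, and_iff_right numBridges_diagram,
    hasTrivialComponent_diagram_iff]
  push Not
  exact forall_congr' fun x => ⟨fun h _ => h, fun h => h (mu_apply_ne x)⟩

theorem ncard_sameCycle_mu_inter_E {e : B.Label} (he : e ∈ B.E) :
    ({x | B.mu.SameCycle e x} ∩ B.E).ncard = 2 := by
  rw [← fixedPoints_gamma]
  exact ncard_sameCycle_mul_inter_fixedPoints gamma_involutive phi_involutive
    (fun x h => B.phi_fst_ne x (congrArg Sigma.fst h)) (gamma_eq_self he)
    (B.mu.injective.mem_periodicPts e)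

end Components

end ThreeButterfly

theorem mainTheorem4 (B : ThreeButterfly) :
    B.IsSchubertForm ↔
      ∃ τ : Fin 3 → Equiv.Perm B.Label,
        (∀ i, (τ i).IsCycle) ∧
        (∀ i j, i ≠ j → (τ i).Disjoint (τ j)) ∧
        B.mu = τ 0 * τ 1 * τ 2 ∧
        ∀ i, ({x | τ i x ≠ x} ∩ B.E).ncard = 2 := by
  have hprod (τ : Fin 3 → Equiv.Perm B.Label) : (List.ofFn τ).prod = τ 0 * τ 1 * τ 2 := by
    simp [List.ofFn_succ, mul_assoc]
  simp only [← hprod]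
  exact B.isSchubertForm_iff.trans <|
    forall_exists_sameCycle_iff_exists_cycles two_ne_zero (fun e _ => B.mu_apply_ne e) B.ncard_E
      fun e he => B.ncard_sameCycle_mu_inter_E he
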